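/- Let $\mathcal C_1,\mathcal C_2$ be quantum channels (completely positive trace-preserving linear maps) with the same finite-dimensional, nonzero input Hilbert space $A$ and the same finite-dimensional output Hilbert space $B$. For density matrices let $F(\rho,\sigma)=\bigl(\operatorname{Tr}\sqrt{\sqrt\rho\,\sigma\sqrt\rho}\bigr)^2$ denote the (squared) fidelity, and define the fidelity divergence $$\partial F(\mathcal C_1,\mathcal C_2)=\inf_R\ \inf_{\rho_1,\rho_2}\ \frac{F\bigl[(\mathcal C_1\otimes\mathcal I_R)(\rho_1),(\mathcal C_2\otimes\mathcal I_R)(\rho_2)\bigr]}{F(\rho_1,\rho_2)},$$ where $R$ ranges over all finite-dimensional reference systems and $(\rho_1,\rho_2)$ over all pairs of density matrices on $A\otimes R$ with $F(\rho_1,\rho_2)\neq 0$. A sequential (adaptive) strategy with $N\ge 1$ queries to an unknown channel $\mathcal C\in\{\mathcal C_1,\mathcal C_2\}$ consists of: a state on $A\otimes R_1$; $N$ applications of $\mathcal C$ to $A$, where between the $t$-th and the $(t+1)$-th application an arbitrary channel from $B\otimes R_t$ to $A\otimes R_{t+1}$ is applied ($R_1,\dots,R_N$ being arbitrary finite-dimensional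 reference systems); and a final two-outcome POVM $\{P_1,P_2\}$ on $B\otimes R_N$, whose outcome is the guess for the channel. (For $N=0$ it is just a two-outcome measurement on a trivial system.) Its error probability is $\tfrac12\Pr[\text{guess }2\mid\mathcal C_1]+\tfrac12\Pr[\text{guess }1\mid\mathcal C_2]$, and $p^{\rm seq}_{\rm err}(\mathcal C_1,\mathcal C_2;N)$ is the infimum of the error probability over all such strategies. Then: 1. for every $N\ge 0$, every sequential strategy with $N$ queries has error probability at least $\partial F(\mathcal C_1,\mathcal C_2)^N/4$, that is, $$p^{\rm seq}_{\rm err}(\mathcal C_1,\mathcal C_2;N)\ \ge\ \frac{\partial F(\mathcal C_1,\mathcal C_2)^N}{4};$$ 2. the value of $\partial F(\mathcal C_1,\mathcal C_2)$ does not change if the infimum is restricted to pairs of pure states $\rho_1,\rho_2$ (with $R$ still ranging over all finite-dimensional reference systems). -/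

import Mathlib

open scoped ComplexOrder MatrixOrder Matrix

noncomputable section

universe u v

/-- `ρ` is a density matrix on the finite-dimensional Hilbert space `ℂ^s`. -/
structure IsDensity {s : Type*} [Fintype s] (ρ : Matrix s s ℂ) : Prop where
  posSemidef : ρ.PosSemidef
  trace_eq_one : ρ.trace = 1

/-- `ρ` is of the form `|ψ⟩⟨ψ|`. (A density matrix of this form is a pure state: its trace being `1`
forces `ψ` to be a unit vector.) -/
def IsPure {s : Type*} (ρ : Matrix s s ℂ) : Prop :=
  ∃ ψ : s → ℂ, ρ = Matrix.vecMulVec ψ (star ψ)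

/-- The (squared, Uhlmann) fidelity `F(ρ, σ) = (Tr √(√ρ σ √ρ))²`, which for pure states is
`|⟨ψ|φ⟩|²`. -/
def fidelity {s : Type*} [Fintype s] [DecidableEq s] (ρ σ : Matrix s s ℂ) : ℝ :=
  (CFC.sqrt (CFC.sqrt ρ * σ * CFC.sqrt ρ)).trace.re ^ 2

/-- The map `Φ ⊗ id_R`, acting on matrices on the joint system `a × R`: it applies `Φ` to each of the
blocks `(i, j) ↦ X (i, p) (j, q)`, where `p, q` are indices of the reference system. -/
def tensorId {a b : Type*} (Φ : Matrix a a ℂ →ₗ[ℂ] Matrix b b ℂ) {R : Type*}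
    (X : Matrix (a × R) (a × R) ℂ) : Matrix (b × R) (b × R) ℂ :=
  Matrix.of fun x y => Φ (Matrix.of fun i j => X (i, x.2) (j, y.2)) x.1 y.1

/-- A quantum channel from `ℂ^a` to `ℂ^b`: a completely positive trace-preserving linear map. -/
structure QChannel (a : Type*) (b : Type*) [Fintype a] [Fintype b] where
  map : Matrix a a ℂ →ₗ[ℂ] Matrix b b ℂ
  completelyPositive : ∀ (k : ℕ) (X : Matrix (a × Fin k) (a × Fin k) ℂ),
    X.PosSemidef → (tensorId map X).PosSemidef
  tracePreserving : ∀ X : Matrix a a ℂ, (map X).trace = X.trace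

section Divergence

variable {a b : Type*} [Fintype a] [DecidableEq a] [Fintype b] [DecidableEq b]

/-- The fidelity divergence: the infimum, over all finite-dimensional reference systems `R = ℂ^r` and
all pairs of states `ρ₁, ρ₂` of the input and the reference with `F(ρ₁, ρ₂) ≠ 0`, of
`F((C₁ ⊗ id) ρ₁, (C₂ ⊗ id) ρ₂) / F(ρ₁, ρ₂)`. -/
def fidelityDivergence (C₁ C₂ : QChannel a b) : ℝ :=
  sInf {x : ℝ | ∃ (r : ℕ) (ρ₁ ρ₂ : Matrix (a × Fin r) (a × Fin r) ℂ),
    IsDensity ρ₁ ∧ IsDensity ρ₂ ∧ fidelity ρ₁ ρ₂ ≠ 0 ∧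
    x = fidelity (tensorId C₁.map ρ₁) (tensorId C₂.map ρ₂) / fidelity ρ₁ ρ₂}

/-- The same infimum, over pairs of pure states only. -/
def pureFidelityDivergence (C₁ C₂ : QChannel a b) : ℝ :=
  sInf {x : ℝ | ∃ (r : ℕ) (ρ₁ ρ₂ : Matrix (a × Fin r) (a × Fin r) ℂ),
    IsDensity ρ₁ ∧ IsPure ρ₁ ∧ IsDensity ρ₂ ∧ IsPure ρ₂ ∧ fidelity ρ₁ ρ₂ ≠ 0 ∧
    x = fidelity (tensorId C₁.map ρ₁) (tensorId C₂.map ρ₂) / fidelity ρ₁ ρ₂}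

end Divergence

/-- A quantum measurement (POVM) on `ℂ^s` with two outcomes: outcome `0` is the guess "the channel is
`C₁`", outcome `1` is the guess "the channel is `C₂`". -/
structure BinaryMeasurement (s : Type*) [Fintype s] [DecidableEq s] where
  effect : Fin 2 → Matrix s s ℂ
  posSemidef : ∀ i, (effect i).PosSemidef
  sum_eq_one : effect 0 + effect 1 = 1

/-- What an experimenter who currently holds the system `ℂ^s` can still do with `n` more queries to a
black box with input `ℂ^a` and output `ℂ^b`. With no query left, measure the system held. Otherwise
intervene with a channel from the system held to the input of the box and a reference system `ℂ^r`,
send the input through the box, and go on with the output of the box and the reference. -/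
inductive SeqProtocol (a : Type u) (b : Type v) [Fintype a] [Fintype b] [DecidableEq b] :
    ℕ → (s : Type v) → [Fintype s] → [DecidableEq s] → Type (max u (v + 1))
  | measure {s : Type v} [Fintype s] [DecidableEq s] (M : BinaryMeasurement s) :
      SeqProtocol a b 0 s
  | query {n : ℕ} {s : Type v} [Fintype s] [DecidableEq s] (r : ℕ)
      (U : QChannel s (a × Fin r)) (next : SeqProtocol a b n (b × Fin r)) :
      SeqProtocol a b (n + 1) s

/-- The probability of the guess `i` when the box is `C` and the system currently held is in
state `ρ`. -/
def SeqProtocol.guessProb {a : Type u} {b : Type v} [Fintype a] [Fintype b] [DecidableEq b]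
    (C : QChannel a b) (i : Fin 2) : {n : ℕ} → {s : Type v} → [Fintype s] → [DecidableEq s] →
    SeqProtocol a b n s → Matrix s s ℂ → ℝ
  | _, _, _, _, @SeqProtocol.measure _ _ _ _ _ _ _ _ M, ρ => (M.effect i * ρ).trace.re
  | _, _, _, _, @SeqProtocol.query _ _ _ _ _ _ _ _ _ _ U next, ρ =>
      next.guessProb C i (tensorId C.map (U.map ρ))

/-- A sequential (adaptive) strategy with `N` queries starts from the trivial one-dimensional system;
its first intervention (if `N > 0`) is the preparation of a state of the input of the box and a
reference system. -/
abbrev SeqStrategy (a : Type u) (b : Type v) [Fintype a] [Fintype b] [DecidableEq b] (N : ℕ) :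
    Type (max u (v + 1)) :=
  SeqProtocol a b N PUnit.{v + 1}

/-- The error probability of a strategy when the channel is `C₁` or `C₂` with probability `1/2`
each. -/
def SeqStrategy.errorProb {a : Type u} {b : Type v} [Fintype a] [Fintype b] [DecidableEq b] {N : ℕ}
    (S : SeqStrategy a b N) (C₁ C₂ : QChannel a b) : ℝ :=
  1 / 2 * SeqProtocol.guessProb C₁ 1 S 1 + 1 / 2 * SeqProtocol.guessProb C₂ 0 S 1

/-- The minimum error probability over all sequential strategies with `N` queries. -/
def seqErrorProb {a : Type u} {b : Type v} [Fintype a] [Fintype b] [DecidableEq b]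
    (C₁ C₂ : QChannel a b) (N : ℕ) : ℝ :=
  ⨅ S : SeqStrategy a b N, S.errorProb C₁ C₂

end

/-! The root fidelity of positive semidefinite `ρ`, `σ` is the maximum of `Re Tr X` over positive
semidefinite block matrices with diagonal blocks `ρ`, `σ` and off-diagonal block `X`
(`trace_qubitBlock_le_rootFidelity`, `exists_qubitBlock_eq_rootFidelity`). Applying a channel or a
partial trace blockwise to an optimal block matrix keeps it positive and keeps `Tr X`, so fidelity
cannot decrease. A Gram factor of the optimal matrix gives Uhlmann purifications.

Hence an intervention between queries does not lower the fidelity of the two candidate states, and a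
query multiplies it by at least `∂F`. Starting from fidelity 1, the final states have fidelity at
least `∂F ^ N`, and Cauchy–Schwarz for the measurement bounds the error below by a quarter of that.
For pure pairs, purifying does not lower the denominator of the ratio and, by monotonicity under
partial trace, does not raise its numerator. -/

noncomputable section

/-! ### Positive semidefinite 2×2 block matrices -/

section Blocks

variable {s n : Type*}

/-- The block of a matrix on `ℂ^s ⊗ ℂ²` at position `(p, q)` of the second factor. -/
def qubitBlock (M : Matrix (s × Fin 2) (s × Fin 2) ℂ) (p q : Fin 2) : Matrix s s ℂ :=
  M.submatrix (fun i => (i, p)) (fun i => (i, q))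

theorem qubitBlock_posSemidef {M : Matrix (s × Fin 2) (s × Fin 2) ℂ} (hM : M.PosSemidef)
    (p : Fin 2) : (qubitBlock M p p).PosSemidef :=
  hM.submatrix _

theorem qubitBlock_conjTranspose {M : Matrix (s × Fin 2) (s × Fin 2) ℂ} (hM : M.PosSemidef)
    (p q : Fin 2) : (qubitBlock M p q)ᴴ = qubitBlock M q p := by
  ext i j
  exact hM.1.apply _ _

/-- Testing a positive semidefinite block matrix with a pair of matrices. -/
theorem Matrix.PosSemidef.qubitBlock_test [Fintype s] [Fintype n]
    {M : Matrix (s × Fin 2) (s × Fin 2) ℂ} (hM : M.PosSemidef) (V W : Matrix n s ℂ) :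
    0 ≤ (V * qubitBlock M 0 0 * Vᴴ).trace.re + 2 * (V * qubitBlock M 0 1 * Wᴴ).trace.re
      + (W * qubitBlock M 1 1 * Wᴴ).trace.re := by
  set K : Matrix n (s × Fin 2) ℂ := Matrix.of fun i x => (if x.2 = 0 then V else W) i x.1 with hK
  have h := (hM.mul_mul_conjTranspose_same K).trace_nonneg
  have e : K * M * Kᴴ = (V * qubitBlock M 0 0 * Vᴴ + W * qubitBlock M 1 1 * Wᴴ)
      + (V * qubitBlock M 0 1 * Wᴴ + W * qubitBlock M 1 0 * Vᴴ) := by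
    ext i j
    simp only [hK, Matrix.mul_apply, Fintype.sum_prod_type, Fin.sum_univ_two, Matrix.of_apply,
      Matrix.conjTranspose_apply, Matrix.add_apply, qubitBlock, Matrix.submatrix_apply,
      Finset.sum_add_distrib, add_mul, if_true, one_ne_zero, if_false]
    ring
  have e2 : (W * qubitBlock M 1 0 * Vᴴ).trace = star (V * qubitBlock M 0 1 * Wᴴ).trace := by
    rw [← Matrix.trace_conjTranspose]
    simp only [Matrix.conjTranspose_mul, Matrix.conjTranspose_conjTranspose,
      qubitBlock_conjTranspose hM, Matrix.mul_assoc]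
  rw [e, Matrix.trace_add, Matrix.trace_add, Matrix.trace_add, e2] at h
  have h2 := (Complex.le_def.1 h).1
  simp at h2
  linarith

end Blocks

theorem Matrix.PosSemidef.trace_mul_re_nonneg {s : Type*} [Fintype s] [DecidableEq s]
    {A B : Matrix s s ℂ} (hA : A.PosSemidef) (hB : B.PosSemidef) : 0 ≤ (A * B).trace.re := by
  obtain ⟨C, rfl⟩ := (CStarAlgebra.nonneg_iff_eq_star_mul_self (a := A)).1 hA.nonneg
  have h := (hB.mul_mul_conjTranspose_same C).trace_nonneg
  rw [Matrix.star_eq_conjTranspose, Matrix.mul_assoc, Matrix.trace_mul_comm]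
  exact (Complex.le_def.1 h).1

/-! ### Variational characterisation of the root fidelity -/

section RootFidelity

variable {s : Type*} [Fintype s] [DecidableEq s]

/-- The root fidelity `Tr √(√ρ σ √ρ)`. -/
def rootFidelity (ρ σ : Matrix s s ℂ) : ℝ :=
  (CFC.sqrt (CFC.sqrt ρ * σ * CFC.sqrt ρ)).trace.re

theorem fidelity_eq_rootFidelity_sq (ρ σ : Matrix s s ℂ) :
    fidelity ρ σ = rootFidelity ρ σ ^ 2 := rfl

theorem posSemidef_cfcSqrt (A : Matrix s s ℂ) : (CFC.sqrt A).PosSemidef :=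
  Matrix.nonneg_iff_posSemidef.1 (CFC.sqrt_nonneg A)

theorem rootFidelity_nonneg (ρ σ : Matrix s s ℂ) : 0 ≤ rootFidelity ρ σ :=
  (Complex.le_def.1 (posSemidef_cfcSqrt _).trace_nonneg).1

theorem posSemidef_cfcSqrt_conj {ρ σ : Matrix s s ℂ} (hσ : σ.PosSemidef) :
    (CFC.sqrt ρ * σ * CFC.sqrt ρ).PosSemidef := by
  have := hσ.mul_mul_conjTranspose_same (CFC.sqrt ρ)
  rwa [(posSemidef_cfcSqrt ρ).1.eq] at this

theorem cfcSqrt_conj_sq {ρ σ : Matrix s s ℂ} (hσ : σ.PosSemidef) :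
    CFC.sqrt (CFC.sqrt ρ * σ * CFC.sqrt ρ) * CFC.sqrt (CFC.sqrt ρ * σ * CFC.sqrt ρ)
      = CFC.sqrt ρ * σ * CFC.sqrt ρ :=
  CFC.sqrt_mul_sqrt_self _ (posSemidef_cfcSqrt_conj hσ).nonneg

theorem posDef_add_smul_one {s : Type*} [DecidableEq s] {A : Matrix s s ℂ} (hA : A.PosSemidef) {ε : ℝ} (hε : 0 < ε) :
    (A + (ε : ℂ) • (1 : Matrix s s ℂ)).PosDef := by
  refine Matrix.PosDef.posSemidef_add hA (Matrix.PosDef.one.smul ?_)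
  exact_mod_cast hε

/-- With `E = r + ε`, `E² - r² = 2εr + ε²` is positive, so `E⁻¹r²E⁻¹ ≤ 1`. This replaces `r⁻¹r²r⁻¹ =
1` when `r = √ρ` is singular. -/
theorem trace_inv_add_conj_le {r Q : Matrix s s ℂ} (hr : r.PosSemidef) (hQ : Q.PosSemidef)
    {ε : ℝ} (hε : 0 < ε) :
    (Q * ((r + (ε : ℂ) • (1 : Matrix s s ℂ))⁻¹ * (r * r)
      * (r + (ε : ℂ) • (1 : Matrix s s ℂ))⁻¹)).trace.re ≤ Q.trace.re := by
  set E := r + (ε : ℂ) • (1 : Matrix s s ℂ) with hE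
  have hEd : E.PosDef := posDef_add_smul_one hr hε
  have hu : IsUnit E.det := (Matrix.isUnit_iff_isUnit_det _).1 hEd.isUnit
  have h1 : (E * E - r * r).PosSemidef := by
    have : E * E - r * r = ((2 * ε : ℝ) : ℂ) • r + ((ε * ε : ℝ) : ℂ) • (1 : Matrix s s ℂ) := by
      rw [hE]
      simp only [add_mul, mul_add, Matrix.smul_mul, Matrix.mul_smul, Matrix.one_mul, Matrix.mul_one]
      push_cast
      module
    rw [this]
    refine (hr.smul ?_).add (Matrix.PosSemidef.one.smul ?_)
    · exact_mod_cast (by positivity : 0 ≤ 2 * ε)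
    · exact_mod_cast (by positivity : 0 ≤ ε * ε)
  have h2 := h1.mul_mul_conjTranspose_same E⁻¹
  rw [hEd.inv.isHermitian.eq] at h2
  have h3 : E⁻¹ * (E * E - r * r) * E⁻¹ = 1 - E⁻¹ * (r * r) * E⁻¹ := by
    rw [mul_sub, sub_mul, ← mul_assoc, Matrix.nonsing_inv_mul _ hu, one_mul,
      Matrix.mul_nonsing_inv _ hu]
  rw [h3] at h2
  have h4 := hQ.trace_mul_re_nonneg h2
  rw [mul_sub, mul_one, Matrix.trace_sub, Complex.sub_re] at h4
  linarith

/-- The off-diagonal block of a positive semidefinite block matrix is bounded by the root fidelity of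
its diagonal blocks. -/
theorem trace_qubitBlock_le_rootFidelity {M : Matrix (s × Fin 2) (s × Fin 2) ℂ}
    (hM : M.PosSemidef) :
    (qubitBlock M 0 1).trace.re ≤ rootFidelity (qubitBlock M 0 0) (qubitBlock M 1 1) := by
  set ρ := qubitBlock M 0 0 with hρ
  set σ := qubitBlock M 1 1 with hσ
  have pρ : ρ.PosSemidef := qubitBlock_posSemidef hM 0
  have pσ : σ.PosSemidef := qubitBlock_posSemidef hM 1
  set r := CFC.sqrt ρ with hr
  set T := CFC.sqrt (r * σ * r) with hT
  have pr : r.PosSemidef := posSemidef_cfcSqrt ρ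
  have pT : T.PosSemidef := posSemidef_cfcSqrt _
  have hrr : r * r = ρ := CFC.sqrt_mul_sqrt_self ρ pρ.nonneg
  have hTT : T * T = r * σ * r := cfcSqrt_conj_sq pσ
  -- `T` and `r` may be singular: `D = T + δ` and `E = r + ε` regularise them, and `ε → 0` is taken
  -- before `δ → 0`.
  have key : ∀ δ : ℝ, 0 < δ →
      2 * (qubitBlock M 0 1).trace.re ≤ 2 * T.trace.re + δ * Fintype.card s := by
    intro δ hδ
    set D := T + (δ : ℂ) • (1 : Matrix s s ℂ) with hD
    have pD : D.PosDef := posDef_add_smul_one pT hδ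
    have uD : IsUnit D.det := (Matrix.isUnit_iff_isUnit_det _).1 pD.isUnit
    set S := CFC.sqrt D with hS
    have pS : S.PosSemidef := posSemidef_cfcSqrt D
    have hSS : S * S = D := CFC.sqrt_mul_sqrt_self D pD.posSemidef.nonneg
    have uS : IsUnit S.det := by
      rw [← hSS, Matrix.det_mul] at uD
      exact isUnit_of_mul_isUnit_left uD
    have hSi : S⁻¹ * S⁻¹ = D⁻¹ := by rw [← Matrix.mul_inv_rev, hSS]
    have step : ∀ ε : ℝ, 0 < ε → 2 * (qubitBlock M 0 1).trace.re ≤ D.trace.re +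
        (D⁻¹ * ((r + (ε : ℂ) • (1 : Matrix s s ℂ)) * σ
          * (r + (ε : ℂ) • (1 : Matrix s s ℂ)))).trace.re := by
      intro ε hε
      have hb := trace_inv_add_conj_le pr pD.posSemidef hε
      set E := r + (ε : ℂ) • (1 : Matrix s s ℂ) with hE
      have hEd : E.PosDef := posDef_add_smul_one pr hε
      have uE : IsUnit E.det := (Matrix.isUnit_iff_isUnit_det _).1 hEd.isUnit
      -- By cyclicity the cross term is exactly `-2 Re Tr X`, while the diagonal terms become `Tr(D
      -- E⁻¹ρE⁻¹) ≤ Tr D` and `Tr(D⁻¹ EσE)`.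
      have t := hM.qubitBlock_test (S * E⁻¹) (-(S⁻¹ * E))
      have c1 : (S * E⁻¹)ᴴ = E⁻¹ * S := by
        rw [Matrix.conjTranspose_mul, hEd.inv.isHermitian.eq, pS.1.eq]
      have c2 : (S⁻¹ * E)ᴴ = E * S⁻¹ := by
        rw [Matrix.conjTranspose_mul, hEd.isHermitian.eq, pS.inv.1.eq]
      have t1 : (S * E⁻¹ * ρ * (E⁻¹ * S)).trace = (D * (E⁻¹ * (r * r) * E⁻¹)).trace := by
        rw [← hSS, hrr, ← mul_assoc (S * E⁻¹ * ρ), Matrix.trace_mul_comm _ S]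
        simp only [mul_assoc]
      have t2 : (S * E⁻¹ * qubitBlock M 0 1 * (E * S⁻¹)).trace = (qubitBlock M 0 1).trace := by
        rw [Matrix.trace_mul_comm]
        simp only [← mul_assoc]
        rw [mul_assoc E, Matrix.nonsing_inv_mul _ uS, mul_one, Matrix.mul_nonsing_inv _ uE, one_mul]
      have t3 : (S⁻¹ * E * σ * (E * S⁻¹)).trace = (D⁻¹ * (E * σ * E)).trace := by
        rw [← hSi, ← mul_assoc (S⁻¹ * E * σ), Matrix.trace_mul_comm _ S⁻¹]
        simp only [mul_assoc]
      rw [Matrix.conjTranspose_neg, Matrix.mul_neg, Matrix.mul_neg, Matrix.neg_mul, Matrix.neg_mul,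
        neg_neg, Matrix.trace_neg, Complex.neg_re, c1, c2, ← hρ, ← hσ, t1, t2, t3] at t
      linarith
    have lim : 2 * (qubitBlock M 0 1).trace.re ≤ D.trace.re + (D⁻¹ * (r * σ * r)).trace.re := by
      set f : ℝ → ℝ := fun ε => D.trace.re + (D⁻¹ * ((r + (ε : ℂ) • (1 : Matrix s s ℂ)) * σ
          * (r + (ε : ℂ) • (1 : Matrix s s ℂ)))).trace.re with hf
      have hc : Continuous f := by
        have h1 : Continuous fun ε : ℝ => r + (ε : ℂ) • (1 : Matrix s s ℂ) :=
          continuous_const.add (Complex.continuous_ofReal.smul continuous_const)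
        exact continuous_const.add (Complex.continuous_re.comp (Continuous.matrix_trace
          (continuous_const.mul ((h1.mul continuous_const).mul h1))))
      have h0 : f 0 = D.trace.re + (D⁻¹ * (r * σ * r)).trace.re := by simp [hf]
      rw [← h0]
      refine ge_of_tendsto (hc.continuousWithinAt (s := Set.Ioi 0) (x := 0)) ?_
      filter_upwards [self_mem_nhdsWithin] with ε hε using step ε hε
    have hDT : (D⁻¹ * (r * σ * r)).trace.re ≤ T.trace.re := by
      have e : T - D⁻¹ * (T * T) = (δ : ℂ) • (D⁻¹ * T) := by
        have : D * T = T * T + (δ : ℂ) • T := by rw [hD, add_mul, Matrix.smul_mul, one_mul]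
        calc T - D⁻¹ * (T * T) = D⁻¹ * (D * T) - D⁻¹ * (T * T) := by
              rw [← mul_assoc D⁻¹ D T, Matrix.nonsing_inv_mul _ uD, one_mul]
          _ = _ := by rw [this, mul_add, add_sub_cancel_left, Matrix.mul_smul]
      have h := pD.inv.posSemidef.trace_mul_re_nonneg pT
      have h2 := congrArg (fun X => (Matrix.trace X).re) e
      simp only [Matrix.trace_sub, Complex.sub_re, Matrix.trace_smul, smul_eq_mul,
        Complex.re_ofReal_mul] at h2
      rw [← hTT]
      nlinarith [mul_nonneg hδ.le h]
    have hDtr : D.trace.re = T.trace.re + δ * Fintype.card s := by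
      rw [hD, Matrix.trace_add, Matrix.trace_smul, Matrix.trace_one]
      simp
    linarith
  have : 2 * (qubitBlock M 0 1).trace.re ≤ 2 * T.trace.re := by
    have hc : Continuous fun δ : ℝ => 2 * T.trace.re + δ * Fintype.card s := by fun_prop
    have h0 : 2 * T.trace.re + (0 : ℝ) * Fintype.card s = 2 * T.trace.re := by ring
    rw [← h0]
    refine ge_of_tendsto (hc.continuousWithinAt (s := Set.Ioi 0) (x := 0)) ?_
    filter_upwards [self_mem_nhdsWithin] with δ hδ using key δ hδ
  change _ ≤ T.trace.re
  linarith

/-- A generalised inverse of a positive semidefinite matrix. -/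
theorem exists_pseudoinverse {T : Matrix s s ℂ} (hT : T.PosSemidef) :
    ∃ P : Matrix s s ℂ, P.IsHermitian ∧ P * (T * T) = T ∧ (1 - P * (T * T) * P).PosSemidef := by
  have sa : IsSelfAdjoint T := hT.1
  have hc : ∀ f : ℝ → ℝ, ContinuousOn f (spectrum ℝ T) := fun f =>
    (Matrix.finite_real_spectrum (A := T)).continuousOn f
  have hid : cfc (fun x : ℝ => x) T = T := cfc_id' ℝ T
  have hTT : T * T = cfc (fun x : ℝ => x * x) T := by
    rw [cfc_mul _ _ T (hc _) (hc _), hid]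
  -- The convention `0⁻¹ = 0` makes this vanish on the kernel of `T`.
  refine ⟨cfc (fun x : ℝ => x⁻¹) T, cfc_predicate _ T, ?_, ?_⟩
  · rw [hTT, ← cfc_mul _ _ T (hc _) (hc _)]
    conv_rhs => rw [← hid]
    refine cfc_congr fun x _ => ?_
    by_cases hx : x = 0
    · simp [hx]
    · field_simp
  · rw [hTT, ← cfc_mul _ _ T (hc _) (hc _), ← cfc_mul _ _ T (hc _) (hc _),
      ← cfc_one ℝ T, ← cfc_sub _ _ T (hc _) (hc _)]
    refine Matrix.nonneg_iff_posSemidef.1 (cfc_nonneg fun x _ => ?_)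
    by_cases hx : x = 0
    · simp [hx]
    · have : x⁻¹ * (x * x) * x⁻¹ = 1 := by field_simp
      simp [this]

/-- The root fidelity is attained by a positive semidefinite block matrix. -/
theorem exists_qubitBlock_eq_rootFidelity {ρ σ : Matrix s s ℂ} (hρ : ρ.PosSemidef)
    (hσ : σ.PosSemidef) : ∃ M : Matrix (s × Fin 2) (s × Fin 2) ℂ, M.PosSemidef ∧
      qubitBlock M 0 0 = ρ ∧ qubitBlock M 1 1 = σ ∧
      (qubitBlock M 0 1).trace.re = rootFidelity ρ σ := by
  set r := CFC.sqrt ρ with hr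
  set q := CFC.sqrt σ with hq
  set T := CFC.sqrt (r * σ * r) with hT
  have pr : r.PosSemidef := posSemidef_cfcSqrt ρ
  have pq : q.PosSemidef := posSemidef_cfcSqrt σ
  have pT : T.PosSemidef := posSemidef_cfcSqrt _
  have hrr : r * r = ρ := CFC.sqrt_mul_sqrt_self ρ hρ.nonneg
  have hqq : q * q = σ := CFC.sqrt_mul_sqrt_self σ hσ.nonneg
  have hTT : T * T = r * σ * r := cfcSqrt_conj_sq hσ
  obtain ⟨P, hP, hPT, hP1⟩ := exists_pseudoinverse pT
  -- `K` is the contraction in the polar decomposition of `√ρ√σ`: `KKᴴ` is the support projection of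
  -- `T`. The Schur complement makes the block matrix with off-diagonal `K` positive; conjugation by
  -- `diag(√ρ, √σ)` then gives off-diagonal trace `Tr(P T²) = Tr T`.
  set K := P * (r * q) with hK
  have hKh : Kᴴ = q * r * P := by
    rw [hK, Matrix.conjTranspose_mul, Matrix.conjTranspose_mul, pq.1.eq, pr.1.eq, hP.eq]
  have hKK : K * Kᴴ = P * (T * T) * P := by
    rw [hKh, hTT, ← hqq, hK]
    simp only [mul_assoc]
  have hblk : (Matrix.fromBlocks 1 K Kᴴ (1 : Matrix s s ℂ)).PosSemidef := by
    let : Invertible (1 : Matrix s s ℂ) := invertibleOne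
    rw [Matrix.PosDef.fromBlocks₂₂ _ _ Matrix.PosDef.one, inv_one, mul_one, hKK]
    exact hP1
  have hN := (hblk.mul_mul_conjTranspose_same
    (Matrix.fromBlocks r 0 0 q))
  rw [Matrix.fromBlocks_conjTranspose, pr.1.eq, pq.1.eq] at hN
  simp only [Matrix.fromBlocks_multiply, Matrix.conjTranspose_zero, mul_zero, zero_mul, add_zero,
    zero_add, mul_one, hrr, hqq] at hN
  refine ⟨_, hN.submatrix (fun x : s × Fin 2 => if x.2 = 0 then Sum.inl x.1 else Sum.inr x.1),
    ?_, ?_, ?_⟩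
  · ext i j; simp [qubitBlock]
  · ext i j; simp [qubitBlock]
  · have : qubitBlock ((Matrix.fromBlocks ρ (r * K * q) (q * Kᴴ * r) σ).submatrix
        (fun x : s × Fin 2 => if x.2 = 0 then Sum.inl x.1 else Sum.inr x.1)
        (fun x : s × Fin 2 => if x.2 = 0 then Sum.inl x.1 else Sum.inr x.1)) 0 1 = r * K * q := by
      ext i j; simp [qubitBlock]
    rw [this]
    change _ = T.trace.re
    rw [mul_assoc, Matrix.trace_mul_comm, hK]
    have : P * (r * q) * q * r = T := by
      rw [← hPT, hTT, ← hqq]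
      simp only [mul_assoc]
    rw [this]

end RootFidelity

/-! ### Monotonicity under channels -/

section Channels

variable {a b s : Type*} [Fintype a] [Fintype b]

theorem QChannel.map_posSemidef (C : QChannel a b) {X : Matrix a a ℂ} (hX : X.PosSemidef) :
    (C.map X).PosSemidef := by
  have h := C.completelyPositive 1 _ (hX.submatrix (Prod.fst : a × Fin 1 → a))
  exact h.submatrix (fun x : b => (x, (0 : Fin 1)))

theorem QChannel.map_isDensity (C : QChannel a b) {X : Matrix a a ℂ} (hX : IsDensity X) :
    IsDensity (C.map X) :=
  ⟨C.map_posSemidef hX.posSemidef, (C.tracePreserving X).trans hX.trace_eq_one⟩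

theorem QChannel.trace_tensorId (C : QChannel a b) {R : Type*} [Fintype R]
    (X : Matrix (a × R) (a × R) ℂ) : (tensorId C.map X).trace = X.trace := by
  have h : ∀ p : R, ∑ x, tensorId C.map X (x, p) (x, p) = ∑ i, X (i, p) (i, p) := fun p =>
    C.tracePreserving (Matrix.of fun i j => X (i, p) (j, p))
  simp only [Matrix.trace, Matrix.diag, Fintype.sum_prod_type_right, h]

theorem QChannel.tensorId_isDensity (C : QChannel a b) {r : ℕ}
    {X : Matrix (a × Fin r) (a × Fin r) ℂ} (hX : IsDensity X) : IsDensity (tensorId C.map X) :=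
  ⟨C.completelyPositive r X hX.posSemidef, (C.trace_tensorId X).trans hX.trace_eq_one⟩

/-- The root fidelity does not decrease under quantum channels. -/
theorem QChannel.rootFidelity_le_map [DecidableEq a] [DecidableEq b] (C : QChannel a b)
    {ρ σ : Matrix a a ℂ} (hρ : ρ.PosSemidef) (hσ : σ.PosSemidef) :
    rootFidelity ρ σ ≤ rootFidelity (C.map ρ) (C.map σ) := by
  obtain ⟨M, hM, h0, h1, h⟩ := exists_qubitBlock_eq_rootFidelity hρ hσ
  -- The second factor of `M` plays the role of a qubit reference, so complete positivity at `k = 2`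
  -- suffices.
  have hb : ∀ p q, qubitBlock (tensorId C.map M) p q = C.map (qubitBlock M p q) := fun _ _ => rfl
  have := trace_qubitBlock_le_rootFidelity (C.completelyPositive 2 M hM)
  rwa [hb, hb, hb, C.tracePreserving, h0, h1, h] at this

end Channels

/-! ### Monotonicity under partial traces -/

section PartialTrace

variable {t u Q : Type*} [Fintype Q]

/-- The partial trace over `Q` of a matrix on a system `t` that is split into `u` and `Q` by `g`. -/
def partialTrace (g : Q → u → t) (X : Matrix t t ℂ) : Matrix u u ℂ :=
  ∑ k, X.submatrix (g k) (g k)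

theorem partialTrace_apply (g : Q → u → t) (X : Matrix t t ℂ) (x y : u) :
    partialTrace g X x y = ∑ k, X (g k x) (g k y) := by
  simp [partialTrace, Matrix.sum_apply]

theorem partialTrace_posSemidef (g : Q → u → t) {X : Matrix t t ℂ} (hX : X.PosSemidef) :
    (partialTrace g X).PosSemidef :=
  Matrix.posSemidef_sum _ fun _ _ => hX.submatrix _

theorem trace_partialTrace [Fintype t] [Fintype u] {g : Q → u → t}
    (hg : Function.Bijective (Function.uncurry g)) (X : Matrix t t ℂ) :
    (partialTrace g X).trace = X.trace := by
  simp only [Matrix.trace, Matrix.diag, partialTrace_apply]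
  rw [← hg.sum_comp fun i => X i i, Fintype.sum_prod_type_right]
  rfl

/-- The root fidelity does not decrease under partial traces. -/
theorem rootFidelity_le_partialTrace [Fintype t] [Fintype u] [DecidableEq t] [DecidableEq u]
    {g : Q → u → t} (hg : Function.Bijective (Function.uncurry g)) {ρ σ : Matrix t t ℂ}
    (hρ : ρ.PosSemidef) (hσ : σ.PosSemidef) :
    rootFidelity ρ σ ≤ rootFidelity (partialTrace g ρ) (partialTrace g σ) := by
  obtain ⟨M, hM, h0, h1, h⟩ := exists_qubitBlock_eq_rootFidelity hρ hσ
  have hb : ∀ p q, qubitBlock (partialTrace (fun k (x : u × Fin 2) => (g k x.1, x.2)) M) p q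
      = partialTrace g (qubitBlock M p q) := by
    intro p q
    ext i j
    simp [qubitBlock, partialTrace_apply]
  have := trace_qubitBlock_le_rootFidelity
    (partialTrace_posSemidef (fun k (x : u × Fin 2) => (g k x.1, x.2)) hM)
  rwa [hb, hb, hb, trace_partialTrace hg, h0, h1, h] at this

theorem bijective_split_reference (a : Type*) {Q R S : Type*} (e : Q × R ≃ S) :
    Function.Bijective (Function.uncurry fun k (x : a × R) => (x.1, e (k, x.2))) := by
  constructor
  · rintro ⟨k, x, p⟩ ⟨l, y, q⟩ hxy
    simp only [Function.uncurry_apply_pair, Prod.mk.injEq, EmbeddingLike.apply_eq_iff_eq] at hxy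
    simp [hxy]
  · rintro ⟨x, k⟩
    exact ⟨((e.symm k).1, x, (e.symm k).2), by simp⟩

/-- A map on `a` commutes with the partial trace over a part of the reference system. -/
theorem tensorId_partialTrace {a b R S : Type*} (Φ : Matrix a a ℂ →ₗ[ℂ] Matrix b b ℂ)
    (f : Q → R → S) (X : Matrix (a × S) (a × S) ℂ) :
    tensorId Φ (partialTrace (fun k (x : a × R) => (x.1, f k x.2)) X)
      = partialTrace (fun k (x : b × R) => (x.1, f k x.2)) (tensorId Φ X) := by
  ext x y
  have h : (Matrix.of fun i j : a =>
      partialTrace (fun k (x : a × R) => (x.1, f k x.2)) X (i, x.2) (j, y.2))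
      = ∑ k, Matrix.of fun i j : a => X (i, f k x.2) (j, f k y.2) := by
    ext i j
    simp [partialTrace_apply, Matrix.sum_apply]
  rw [partialTrace_apply]
  simp only [tensorId, Matrix.of_apply]
  rw [h, map_sum, Matrix.sum_apply]

end PartialTrace

/-! ### Uhlmann purifications -/

section Purification

/-- The root fidelity of two pure states is at least the real part of the overlap. -/
theorem re_dotProduct_le_rootFidelity {t : Type*} [Fintype t] [DecidableEq t] (ψ : Fin 2 → t → ℂ) :
    (ψ 0 ⬝ᵥ star (ψ 1)).re ≤ rootFidelity (Matrix.vecMulVec (ψ 0) (star (ψ 0)))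
      (Matrix.vecMulVec (ψ 1) (star (ψ 1))) := by
  have h := trace_qubitBlock_le_rootFidelity
    (Matrix.posSemidef_vecMulVec_self_star fun x : t × Fin 2 => ψ x.2 x.1)
  exact h

/-- Uhlmann: two states have purifications whose fidelity is at least that of the states. -/
theorem exists_purification {a R : Type*} [Fintype a] [DecidableEq a] [Fintype R] [DecidableEq R]
    {ρ₁ ρ₂ : Matrix (a × R) (a × R) ℂ} (h₁ : IsDensity ρ₁) (h₂ : IsDensity ρ₂) :
    ∃ (m : ℕ) (e : (((a × R) × Fin 2) × R) ≃ Fin m) (τ₁ τ₂ : Matrix (a × Fin m) (a × Fin m) ℂ),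
      IsDensity τ₁ ∧ IsPure τ₁ ∧ IsDensity τ₂ ∧ IsPure τ₂ ∧
      partialTrace (fun k (x : a × R) => (x.1, e (k, x.2))) τ₁ = ρ₁ ∧
      partialTrace (fun k (x : a × R) => (x.1, e (k, x.2))) τ₂ = ρ₂ ∧
      rootFidelity ρ₁ ρ₂ ≤ rootFidelity τ₁ τ₂ := by
  obtain ⟨M, hM, h0, h1, h⟩ := exists_qubitBlock_eq_rootFidelity h₁.posSemidef h₂.posSemidef
  obtain ⟨G, hG⟩ := (CStarAlgebra.nonneg_iff_eq_star_mul_self (a := M)).1 hM.nonneg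
  set e := Fintype.equivFin (((a × R) × Fin 2) × R)
  -- The row index of `G` is the purifying system. Since `M = GᴴG`, tracing it out of `|ψ i⟩⟨ψ j|`
  -- leaves block `(i, j)` of `M`, so the overlap of the two vectors is the trace of the
  -- off-diagonal block.
  set ψ : Fin 2 → a × Fin (Fintype.card (((a × R) × Fin 2) × R)) → ℂ := fun i x =>
    star (G (e.symm x.2).1 ((x.1, (e.symm x.2).2), i)) with hψ
  have bij := bijective_split_reference a e
  have hpt : ∀ i j, partialTrace (fun k (x : a × R) => (x.1, e (k, x.2)))
      (Matrix.vecMulVec (ψ i) (star (ψ j))) = qubitBlock M i j := by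
    intro i j
    ext x y
    rw [partialTrace_apply, hG]
    simp [hψ, qubitBlock, Matrix.mul_apply, Matrix.vecMulVec_apply]
  have hd : ∀ i, (qubitBlock M i i).trace = 1 →
      IsDensity (Matrix.vecMulVec (ψ i) (star (ψ i))) := fun i hi =>
    ⟨Matrix.posSemidef_vecMulVec_self_star _, by rw [← trace_partialTrace bij, hpt, hi]⟩
  refine ⟨_, e, _, _, hd 0 (h0 ▸ h₁.trace_eq_one), ⟨_, rfl⟩, hd 1 (h1 ▸ h₂.trace_eq_one), ⟨_, rfl⟩,
    (hpt 0 0).trans h0, (hpt 1 1).trans h1, ?_⟩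
  refine le_trans (le_of_eq ?_) (re_dotProduct_le_rootFidelity ψ)
  rw [← h, ← hpt 0 1, trace_partialTrace bij, Matrix.trace_vecMulVec]

end Purification

/-! ### Fidelity and measurement error -/

section Measurement

variable {s : Type*} [Fintype s] [DecidableEq s]

/-- Cauchy–Schwarz, from the discriminant of a nonnegative quadratic in `t`. -/
theorem sq_trace_mul_qubitBlock_le {E : Matrix s s ℂ} (hE : E.PosSemidef)
    {M : Matrix (s × Fin 2) (s × Fin 2) ℂ} (hM : M.PosSemidef) :
    (E * qubitBlock M 0 1).trace.re ^ 2
      ≤ (E * qubitBlock M 0 0).trace.re * (E * qubitBlock M 1 1).trace.re := by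
  obtain ⟨B, rfl⟩ := (CStarAlgebra.nonneg_iff_eq_star_mul_self (a := E)).1 hE.nonneg
  rw [Matrix.star_eq_conjTranspose]
  have hcyc : ∀ X : Matrix s s ℂ, (B * X * Bᴴ).trace = (Bᴴ * B * X).trace := fun X => by
    rw [Matrix.trace_mul_comm, ← mul_assoc]
  have key : ∀ t : ℝ, 0 ≤ (Bᴴ * B * qubitBlock M 0 0).trace.re * (t * t)
      + 2 * (Bᴴ * B * qubitBlock M 0 1).trace.re * t + (Bᴴ * B * qubitBlock M 1 1).trace.re := by
    intro t
    have h := hM.qubitBlock_test ((t : ℂ) • B) B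
    simp only [Matrix.conjTranspose_smul, Matrix.smul_mul, Matrix.mul_smul, Matrix.trace_smul,
      hcyc, smul_eq_mul, RCLike.star_def, Complex.conj_ofReal, Complex.re_ofReal_mul] at h
    linarith
  have := discrim_le_zero key
  rw [discrim] at this
  linarith

/-- The fidelity bounds the error of discriminating two states by a measurement. -/
theorem BinaryMeasurement.fidelity_le (E : BinaryMeasurement s) {ρ σ : Matrix s s ℂ}
    (hρ : IsDensity ρ) (hσ : IsDensity σ) :
    fidelity ρ σ ≤ 2 * ((E.effect 1 * ρ).trace.re + (E.effect 0 * σ).trace.re) := by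
  obtain ⟨M, hM, h0, h1, h⟩ := exists_qubitBlock_eq_rootFidelity hρ.posSemidef hσ.posSemidef
  have i0 := sq_trace_mul_qubitBlock_le (E.posSemidef 0) hM
  have i1 := sq_trace_mul_qubitBlock_le (E.posSemidef 1) hM
  rw [h0, h1] at i0 i1
  have add : ∀ X : Matrix s s ℂ,
      (E.effect 0 * X).trace.re + (E.effect 1 * X).trace.re = X.trace.re := fun X => by
    rw [← Complex.add_re, ← Matrix.trace_add, ← add_mul, E.sum_eq_one, one_mul]
  have a1 := add ρ
  have a2 := add σ
  rw [hρ.trace_eq_one, Complex.one_re] at a1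
  rw [hσ.trace_eq_one, Complex.one_re] at a2
  have p1 := (E.posSemidef 1).trace_mul_re_nonneg hρ.posSemidef
  have q0 := (E.posSemidef 0).trace_mul_re_nonneg hσ.posSemidef
  rw [fidelity_eq_rootFidelity_sq, ← h, ← add]
  set x := (E.effect 0 * qubitBlock M 0 1).trace.re
  set y := (E.effect 1 * qubitBlock M 0 1).trace.re
  -- With `p = Tr(E₁ρ)` and `q = Tr(E₀σ)`: `(x + y)² ≤ 2(x² + y²) ≤ 2((1 - p)q + p(1 - q)) ≤ 2(p +
  -- q)`.
  nlinarith [sq_nonneg (x - y), mul_nonneg p1 q0]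

end Measurement

/-! ### Fidelity divergence and its restriction to pure states -/

section Divergence

variable {a b : Type*} [Fintype a] [DecidableEq a] [Fintype b] [DecidableEq b]

theorem fidelity_nonneg {s : Type*} [Fintype s] [DecidableEq s] (ρ σ : Matrix s s ℂ) :
    0 ≤ fidelity ρ σ :=
  sq_nonneg _

theorem fidelity_self {s : Type*} [Fintype s] [DecidableEq s] {ρ : Matrix s s ℂ}
    (hρ : IsDensity ρ) : fidelity ρ ρ = 1 := by
  have h : CFC.sqrt ρ * ρ * CFC.sqrt ρ = ρ * ρ := by
    have e := CFC.sqrt_mul_sqrt_self ρ hρ.posSemidef.nonneg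
    set r := CFC.sqrt ρ
    rw [← e]
    simp only [mul_assoc]
  rw [fidelity, h, CFC.sqrt_mul_self ρ hρ.posSemidef.nonneg, hρ.trace_eq_one]
  simp

theorem fidelityDivergence_nonneg (C₁ C₂ : QChannel a b) : 0 ≤ fidelityDivergence C₁ C₂ := by
  refine Real.sInf_nonneg ?_
  rintro x ⟨r, ρ₁, ρ₂, -, -, -, rfl⟩
  exact div_nonneg (fidelity_nonneg _ _) (fidelity_nonneg _ _)

theorem fidelityDivergence_mul_le (C₁ C₂ : QChannel a b) {r : ℕ}
    {ρ₁ ρ₂ : Matrix (a × Fin r) (a × Fin r) ℂ} (h₁ : IsDensity ρ₁) (h₂ : IsDensity ρ₂) :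
    fidelityDivergence C₁ C₂ * fidelity ρ₁ ρ₂
      ≤ fidelity (tensorId C₁.map ρ₁) (tensorId C₂.map ρ₂) := by
  by_cases h : fidelity ρ₁ ρ₂ = 0
  · rw [h, mul_zero]
    exact fidelity_nonneg _ _
  · rw [← le_div_iff₀ (lt_of_le_of_ne (fidelity_nonneg _ _) (Ne.symm h))]
    refine csInf_le ⟨0, ?_⟩ ⟨r, ρ₁, ρ₂, h₁, h₂, h, rfl⟩
    rintro x ⟨r, ρ₁, ρ₂, -, -, -, rfl⟩
    exact div_nonneg (fidelity_nonneg _ _) (fidelity_nonneg _ _)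

theorem exists_isDensity_isPure (s : Type*) [Fintype s] [DecidableEq s] [Nonempty s] :
    ∃ ρ : Matrix s s ℂ, IsDensity ρ ∧ IsPure ρ := by
  obtain ⟨i⟩ := ‹Nonempty s›
  set ψ : s → ℂ := Pi.single i 1
  exact ⟨_, ⟨Matrix.posSemidef_vecMulVec_self_star ψ, by simp [ψ, Matrix.trace_vecMulVec]⟩, ψ, rfl⟩

theorem fidelityDivergence_eq_pure [Nonempty a] (C₁ C₂ : QChannel a b) :
    fidelityDivergence C₁ C₂ = pureFidelityDivergence C₁ C₂ := by
  refine le_antisymm (le_csInf ?_ ?_) (le_csInf ?_ ?_)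
  -- The set must be nonempty, as `sInf ∅ = 0` in `ℝ`; a pair of equal pure states is admissible.
  · obtain ⟨ρ, hρ, pρ⟩ := exists_isDensity_isPure (a × Fin 1)
    exact ⟨_, 1, _, _, hρ, pρ, hρ, pρ, by simp [fidelity_self hρ], rfl⟩
  · rintro x ⟨r, ρ₁, ρ₂, h₁, -, h₂, -, h, rfl⟩
    rw [le_div_iff₀ (lt_of_le_of_ne (fidelity_nonneg _ _) (Ne.symm h))]
    exact fidelityDivergence_mul_le C₁ C₂ h₁ h₂
  · obtain ⟨ρ, hρ, pρ⟩ := exists_isDensity_isPure (a × Fin 1)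
    exact ⟨_, 1, _, _, hρ, hρ, by simp [fidelity_self hρ], rfl⟩
  · rintro x ⟨r, ρ₁, ρ₂, h₁, h₂, h, rfl⟩
    obtain ⟨m, e, τ₁, τ₂, d₁, p₁, d₂, p₂, t₁, t₂, hF⟩ := exists_purification h₁ h₂
    have pos : 0 < fidelity ρ₁ ρ₂ := lt_of_le_of_ne (fidelity_nonneg _ _) (Ne.symm h)
    have hF' : fidelity ρ₁ ρ₂ ≤ fidelity τ₁ τ₂ :=
      pow_le_pow_left₀ (rootFidelity_nonneg _ _) hF 2
    have bij := bijective_split_reference b e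
    have hN : fidelity (tensorId C₁.map τ₁) (tensorId C₂.map τ₂)
        ≤ fidelity (tensorId C₁.map ρ₁) (tensorId C₂.map ρ₂) := by
      refine pow_le_pow_left₀ (rootFidelity_nonneg _ _) ?_ 2
      have := rootFidelity_le_partialTrace bij (C₁.tensorId_isDensity d₁).posSemidef
        (C₂.tensorId_isDensity d₂).posSemidef
      rwa [← tensorId_partialTrace C₁.map (fun k p => e (k, p)),
        ← tensorId_partialTrace C₂.map (fun k p => e (k, p)), t₁, t₂] at this
    refine le_trans (csInf_le ⟨0, ?_⟩ ⟨m, τ₁, τ₂, d₁, p₁, d₂, p₂, (pos.trans_le hF').ne', rfl⟩)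
      (div_le_div₀ (fidelity_nonneg _ _) hN pos hF')
    rintro x ⟨r, ρ₁, ρ₂, -, -, -, -, -, rfl⟩
    exact div_nonneg (fidelity_nonneg _ _) (fidelity_nonneg _ _)

end Divergence

/-! ### Sequential strategies -/

section Protocols

/-- The channel that discards its input and prepares the basis state `e`. -/
def QChannel.prepare (s : Type*) {t : Type*} [Fintype s] [Fintype t] [DecidableEq t] (e : t) :
    QChannel s t where
  map := (Matrix.traceLinearMap s ℂ ℂ).smulRight (Matrix.single e e 1)
  completelyPositive k X hX := by
    -- The output `|e⟩⟨e| ⊗ Tr_s X` is the sum over `i` of the diagonal blocks of `X`, each placed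
    -- at `e` by a compression.
    set d : t × Fin k → ℂ := fun x => if x.1 = e then 1 else 0 with hd
    have h : ∀ i : s, (Matrix.diagonal d * X.submatrix (fun y : t × Fin k => (i, y.2))
        (fun y : t × Fin k => (i, y.2)) * (Matrix.diagonal d)ᴴ).PosSemidef := fun i =>
      (hX.submatrix _).mul_mul_conjTranspose_same _
    convert Matrix.posSemidef_sum Finset.univ fun i _ => h i using 1
    ext x y
    by_cases hx : x.1 = e <;> by_cases hy : y.1 = e <;>
      simp [tensorId, Matrix.trace, Matrix.sum_apply, Matrix.diagonal_conjTranspose,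
        Matrix.single_apply, hd, hx, hy, eq_comm (a := e)]
  tracePreserving X := by simp

variable {a : Type u} {b : Type v} [Fintype a] [Fintype b] [DecidableEq b]

/-- Needed to pass from a bound on every strategy to one on the infimum. -/
theorem SeqProtocol.nonempty [DecidableEq a] [Nonempty a] (n : ℕ) :
    ∀ (s : Type v) [Fintype s] [DecidableEq s], Nonempty (SeqProtocol a b n s) := by
  induction n with
  | zero =>
    intro s _ _
    exact ⟨.measure ⟨![1, 0], fun i => by
      fin_cases i
      · exact Matrix.PosSemidef.one
      · exact Matrix.PosSemidef.zero, by simp⟩⟩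
  | succ n ih =>
    intro s _ _
    obtain ⟨next⟩ := ih (b × Fin 1)
    obtain ⟨i⟩ := ‹Nonempty a›
    exact ⟨.query 1 (QChannel.prepare s (i, 0)) next⟩

/-- Two different states are needed for the induction: after a query the held state depends on which
channel is in the box. -/
theorem SeqProtocol.fidelityDivergence_pow_mul_le [DecidableEq a] (C₁ C₂ : QChannel a b) {n : ℕ}
    {s : Type v} [Fintype s] [DecidableEq s] (S : SeqProtocol a b n s) :
    ∀ {ρ₁ ρ₂ : Matrix s s ℂ}, IsDensity ρ₁ → IsDensity ρ₂ →
      fidelityDivergence C₁ C₂ ^ n * fidelity ρ₁ ρ₂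
        ≤ 2 * (S.guessProb C₁ 1 ρ₁ + S.guessProb C₂ 0 ρ₂) := by
  induction S with
  | measure M =>
    intro ρ₁ ρ₂ h₁ h₂
    rw [pow_zero, one_mul]
    exact M.fidelity_le h₁ h₂
  | @query n s _ _ r U next ih =>
    intro ρ₁ ρ₂ h₁ h₂
    have d₁ := U.map_isDensity h₁
    have d₂ := U.map_isDensity h₂
    refine le_trans ?_ (ih (C₁.tensorId_isDensity d₁) (C₂.tensorId_isDensity d₂))
    rw [pow_succ, mul_assoc]
    refine mul_le_mul_of_nonneg_left ?_ (pow_nonneg (fidelityDivergence_nonneg C₁ C₂) n)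
    refine le_trans (mul_le_mul_of_nonneg_left ?_ (fidelityDivergence_nonneg C₁ C₂))
      (fidelityDivergence_mul_le C₁ C₂ d₁ d₂)
    exact pow_le_pow_left₀ (rootFidelity_nonneg _ _)
      (U.rootFidelity_le_map h₁.posSemidef h₂.posSemidef) 2

theorem SeqStrategy.fidelityDivergence_pow_le_errorProb [DecidableEq a] (C₁ C₂ : QChannel a b)
    {N : ℕ} (S : SeqStrategy a b N) :
    fidelityDivergence C₁ C₂ ^ N / 4 ≤ S.errorProb C₁ C₂ := by
  have hd : IsDensity (1 : Matrix PUnit.{v + 1} PUnit.{v + 1} ℂ) :=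
    ⟨Matrix.PosSemidef.one, by simp⟩
  have h := SeqProtocol.fidelityDivergence_pow_mul_le C₁ C₂ S hd hd
  rw [fidelity_self hd, mul_one] at h
  rw [SeqStrategy.errorProb]
  linarith

end Protocols

end

theorem mainTheorem2 {a : Type*} {b : Type*} [Fintype a] [DecidableEq a] [Nonempty a]
    [Fintype b] [DecidableEq b] (C₁ C₂ : QChannel a b) :
    (∀ (N : ℕ) (S : SeqStrategy a b N),
      fidelityDivergence C₁ C₂ ^ N / 4 ≤ SeqStrategy.errorProb S C₁ C₂) ∧
    (∀ N : ℕ, fidelityDivergence C₁ C₂ ^ N / 4 ≤ seqErrorProb C₁ C₂ N) ∧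
    fidelityDivergence C₁ C₂ = pureFidelityDivergence C₁ C₂ := by
  refine ⟨fun N S => SeqStrategy.fidelityDivergence_pow_le_errorProb C₁ C₂ S, fun N => ?_,
    fidelityDivergence_eq_pure C₁ C₂⟩
  have : Nonempty (SeqStrategy a b N) := SeqProtocol.nonempty N _
  exact le_ciInf fun S => SeqStrategy.fidelityDivergence_pow_le_errorProb C₁ C₂ S
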